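/- Let $\mathfrak{T}$ be a (generalised) triangulation, i.e. finitely many tetrahedra, some or all of whose triangular faces are glued together in pairs by affine maps (no face being glued to itself); this includes closed, bounded and ideal triangulations of $3$-manifolds. The dual graph of a triangulation, which may have loops and multiple arcs, has one node for each tetrahedron and one arc for each gluing of two faces. Let $S$ be a normal surface in $\mathfrak{T}$, i.e. a surface meeting each tetrahedron in a finite (possibly empty) collection of disjoint normal triangles and quads which match up across the glued faces; $S$ is considered up to normal isotopy. Crushing $\mathfrak{T}$ along $S$ means the following. (1) Cut $\mathfrak{T}$ open along $S$. (2) Collapse each copy of $S$ to a point, so that every normal disc becomes a point; the cells become tetrahedra (one in the middle of each tetrahedron of $\mathfrak{T}$ that meets no quad), $3$-sided footballs and $4$-sided footballs (all of whose faces are bigons) and triangular purses (with two triangular and two bigonal faces). (3) Flatten all footballs to edges and all triangular purses to triangles, the two triangular faces of a purse being identified with its vertices fixed. Finally, separate tetrahedra that are joined only along vertices or edges, i.e. keep only the remaining tetrahedra and those identifications between their triangular faces that result from the face gluings of $\mathfrak{T}$ and the flattenings. Then this procedure gives a well-defined triangulation $\mathfrak{T}^*$: the triangular faces of the remaining tetrahedra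 are glued in pairs, or left unglued, in a unique way. Moreover, the dual graph of $\mathfrak{T}^*$ is an immersion of the dual graph of $\mathfrak{T}$. That is, up to isomorphism it is obtained from the dual graph of $\mathfrak{T}$ by a finite sequence of operations of the following types: a lifting, which removes two different adjacent arcs $(u,v)$ and $(v,w)$ and adds an arc $(u,w)$; the removal of an arc; the removal of a node together with its incident arcs. -/

import Mathlib

/-! ## Triangulations -/

/-- A (generalised) triangulation: tetrahedra indexed by `ι`, each with vertices `0, 1, 2, 3`, some
or all of whose triangular faces are glued together in pairs by affine maps. Face `i` of a
tetrahedron is the face opposite its vertex `i`.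

`glue t i = none` means that face `i` of `t` is not glued (a boundary face).
`glue t i = some (t', p)` means that face `i` of `t` is glued to face `p i` of `t'`, by the affine
map sending each vertex `v ≠ i` of the former to the vertex `p v` of the latter. So the permutation
`p` records a bijection between the vertices of the two faces, extended by `i ↦ p i`.

No condition is put on the links of vertices and edges, so that triangulations of closed and of
bounded 3-manifolds, and ideal triangulations, are all included. -/
structure GenTriangulation (ι : Type*) where
  glue : ι → Fin 4 → Option (ι × Equiv.Perm (Fin 4))
  /-- gluings can be read from either side -/
  glue_symm : ∀ {t i t' p}, glue t i = some (t', p) → glue t' (p i) = some (t, p⁻¹)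
  /-- no face is glued to itself -/
  glue_ne_self : ∀ {t i t' p}, glue t i = some (t', p) → (t', p i) ≠ (t, i)

namespace GenTriangulation

variable {ι : Type*}

/-- The dual graph, with loops and multiple arcs: one node for each tetrahedron and one arc for each
pair of faces glued together. The arc is labelled by the unordered pair of the two faces. -/
def dualGraph (T : GenTriangulation ι) : Graph ι (Sym2 (ι × Fin 4)) where
  vertexSet := Set.univ
  IsLink e x y := ∃ i p, T.glue x i = some (y, p) ∧ e = s((x, i), (y, p i))
  isLink_symm := by
    intro e _
    refine ⟨?_⟩
    rintro x y ⟨i, p, h, rfl⟩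
    exact ⟨p i, p⁻¹, T.glue_symm h, by simp [Sym2.eq_swap]⟩
  eq_or_eq_of_isLink_of_isLink := by
    rintro e x y v w ⟨i, p, -, rfl⟩ ⟨j, q, -, h⟩
    simp only [Sym2.eq_iff, Prod.mk.injEq] at h
    tauto
  left_mem_of_isLink := by simp

end GenTriangulation

/-! ## Normal surfaces -/

/-- The three types of quads in a tetrahedron are indexed by `Fin 3`: a quad of type `q` separates
the vertices `0` and `q + 1` from the other two. `quadSide q v` tells whether the vertex `v` is on
the same side of such a quad as the vertex `0`. -/
def quadSide (q : Fin 3) (v : Fin 4) : Bool := decide (v = 0 ∨ v = q.succ)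

/-- For `i ≠ v`, the type of the quads that have the vertices `i` and `v` on the same side
(with a meaningless value for `i = v`); see `quadSide_eq_iff`. -/
def quadJoining : Fin 4 → Fin 4 → Fin 3 :=
  ![![0, 0, 1, 2], ![0, 0, 2, 1], ![1, 2, 0, 0], ![2, 1, 0, 0]]

theorem quadSide_eq_iff : ∀ (q : Fin 3) (i v : Fin 4), v ≠ i →
    (quadSide q i = quadSide q v ↔ q = quadJoining i v) := by
  decide

/-- A normal surface, up to normal isotopy, in a triangulation: a finite collection of disjoint
triangles and quads in each tetrahedron, which match up across the glued faces.

`tri t v` is the number of triangles of `t` that cut off the vertex `v`, and `quad t q` the number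
of quads of type `q` in `t`. Quads of different types in one tetrahedron would intersect. In face
`i` of `t`, the normal arcs around the vertex `v ≠ i` come from the triangles at `v` and from the
quads that separate `i` and `v` from the two other vertices. -/
structure NormalSurface {ι : Type*} (T : GenTriangulation ι) where
  tri : ι → Fin 4 → ℕ
  quad : ι → Fin 3 → ℕ
  /-- embeddedness: at most one type of quad in each tetrahedron -/
  quad_unique : ∀ {t q q'}, quad t q ≠ 0 → quad t q' ≠ 0 → q = q'
  /-- the normal arcs in two glued faces match up -/
  matching : ∀ {t i t' p}, T.glue t i = some (t', p) → ∀ {v}, v ≠ i →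
    tri t v + quad t (quadJoining i v) = tri t' (p v) + quad t' (quadJoining (p i) (p v))

namespace NormalSurface

variable {ι : Type*} {T : GenTriangulation ι} (S : NormalSurface T)

/-- The number of arcs around the vertex `v` in face `i` of `t`, where `v ≠ i`. -/
def arcs (t : ι) (i v : Fin 4) : ℕ := S.tri t v + S.quad t (quadJoining i v)

/-! ## Cutting along the surface

In each tetrahedron `t`, the triangles at a vertex `v` are numbered `0, 1, 2, …` going away from
`v`, and the quads of type `q` are numbered `0, 1, 2, …` going away from the vertex `0`. -/

/-- The 3-cells obtained by cutting the tetrahedra open along the normal surface. -/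
inductive Cell : Type _
  /-- the cell between the triangles `k - 1` and `k` at `v` (between `v` and the triangle `0`
  if `k = 0`) -/
  | tip (t : ι) (v : Fin 4) (k : Fin (S.tri t v))
  /-- the cell in the middle of a tetrahedron that meets no quad -/
  | core (t : ι) (h : ∀ q, S.quad t q = 0)
  /-- the cell between the quads `k` and `k + 1` -/
  | slab (t : ι) (q : Fin 3) (k : Fin (S.quad t q - 1))
  /-- the cell on one side of all the quads, outside of the triangles: the side is that of the
  vertex `0` for `side = true` and the opposite one for `side = false` -/
  | outer (t : ι) (q : Fin 3) (h : S.quad t q ≠ 0) (side : Bool)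

/-- The pieces into which the faces of the tetrahedra are cut by the normal arcs. Those which are
glued together are listed once for each side. -/
inductive Piece : Type _
  /-- the piece in the middle of face `i` -/
  | middle (t : ι) (i : Fin 4)
  /-- the piece of face `i` between the arcs `k - 1` and `k` around its vertex `v` (between `v` and
  the arc `0` if `k = 0`), where these arcs are numbered going away from `v` -/
  | corner (t : ι) (i v : Fin 4) (hv : v ≠ i) (k : Fin (S.arcs t i v))

/-- `S.IsFace F c`: the piece `F` is a face of the cell `c`. -/
inductive IsFace : S.Piece → S.Cell → Prop
  | middle_core (t : ι) (i : Fin 4) (h : ∀ q, S.quad t q = 0) :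
      IsFace (.middle t i) (.core t h)
  /-- the middle piece of face `i` is on the side of the quads that does not contain `i` -/
  | middle_outer (t : ι) (i : Fin 4) (q : Fin 3) (h : S.quad t q ≠ 0) :
      IsFace (.middle t i) (.outer t q h (!quadSide q i))
  | corner_tip (t : ι) (i v : Fin 4) (hv : v ≠ i) (k : Fin (S.arcs t i v))
      (hk : k.1 < S.tri t v) :
      IsFace (.corner t i v hv k) (.tip t v ⟨k.1, hk⟩)
  /-- the piece between the last triangle at `v` and the first quad on the way from `v` -/
  | corner_outer (t : ι) (i v : Fin 4) (hv : v ≠ i) (k : Fin (S.arcs t i v))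
      (hk : k.1 = S.tri t v) (h : S.quad t (quadJoining i v) ≠ 0) :
      IsFace (.corner t i v hv k) (.outer t (quadJoining i v) h (quadSide (quadJoining i v) v))
  /-- the piece between the quads `m` and `m + 1` -/
  | corner_slab (t : ι) (i v : Fin 4) (hv : v ≠ i) (k : Fin (S.arcs t i v))
      (m : Fin (S.quad t (quadJoining i v) - 1))
      (hk : k.1 = S.tri t v +
        if quadSide (quadJoining i v) v then m.1 + 1
        else S.quad t (quadJoining i v) - 1 - m.1) :
      IsFace (.corner t i v hv k) (.slab t (quadJoining i v) m)

/-! ## Collapsing the surface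

Every normal disc is collapsed to a point, hence so is every normal arc. The middle pieces of faces
become triangles, and the corner pieces become bigons. The cells become
* tetrahedra (`core`, with four triangular faces),
* 3-sided footballs (`tip`, with three bigons as faces),
* 4-sided footballs (`slab`, with four bigons as faces),
* triangular purses (`outer`, with two triangles and two bigons as faces). -/

/-- The vertices of the cells after collapsing: the vertices of the tetrahedra, and a point for each
normal disc. -/
inductive Point (ι : Type*) : Type _
  | vertex (t : ι) (v : Fin 4)
  | triangle (t : ι) (v : Fin 4) (k : ℕ)
  | quad (t : ι) (q : Fin 3) (k : ℕ)

/-- The point to which arc `k` around the vertex `v` of face `i` of `t` collapses, that is, the disc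
which contains this arc: first come the triangles at `v`, then the quads. -/
def arcPoint (t : ι) (i v : Fin 4) (k : ℕ) : Point ι :=
  if k < S.tri t v then .triangle t v k
  else .quad t (quadJoining i v)
    (if quadSide (quadJoining i v) v then k - S.tri t v
      else S.quad t (quadJoining i v) - 1 - (k - S.tri t v))

/-- The vertex `v` of face `i` of `t` (for `0`), followed by the points to which the arcs around `v`
in this face collapse. -/
def levelPoint (t : ι) (i v : Fin 4) : ℕ → Point ι
  | 0 => .vertex t v
  | k + 1 => S.arcPoint t i v k

/-- The corners of the triangles and bigons to which the pieces of the faces collapse: a triangle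
has one corner for each vertex `v` of the face, and a bigon around `v` has one corner on the side
of `v` (`far = false`) and one on the other side (`far = true`). -/
inductive PieceCorner : Type _
  | middle (t : ι) (i v : Fin 4) (hv : v ≠ i)
  | corner (t : ι) (i v : Fin 4) (hv : v ≠ i) (k : Fin (S.arcs t i v)) (far : Bool)

variable {S}

/-- The piece to which a corner belongs. -/
def PieceCorner.piece : S.PieceCorner → S.Piece
  | .middle t i _ _ => .middle t i
  | .corner t i v hv k _ => .corner t i v hv k

/-- The vertex of the collapsed cell which is at a given corner of one of its faces. -/
def PieceCorner.point : S.PieceCorner → Point ι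
  | .middle t i v _ => S.levelPoint t i v (S.arcs t i v)
  | .corner t i v _ k far => S.levelPoint t i v (if far then k.1 + 1 else k.1)

/-- The vertices of the triangle or bigon to which a piece collapses. -/
def Piece.vertices (F : S.Piece) : Set (Point ι) :=
  {P | ∃ x : S.PieceCorner, x.piece = F ∧ x.point = P}

/-- The cells that collapse to tetrahedra. -/
def Cell.IsTetrahedron : S.Cell → Prop
  | .core _ _ => True
  | _ => False

/-- The tetrahedron that contains a cell. -/
def Cell.tet : S.Cell → ι
  | .tip t _ _ => t
  | .core t _ => t
  | .slab t _ _ => t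
  | .outer t _ _ _ => t

variable (S)

/-! ## Flattening -/

/-- The elementary identifications, corner by corner, between the triangles and bigons:
those coming from the face gluings of the triangulation, and those coming from flattening the cells
that are not tetrahedra. Flattening a triangular purse to a triangle identifies its two
triangular faces, and flattening a football to an edge identifies all of its bigons, in each case
with the vertices of the cell fixed. (A bigon is moreover flattened to an edge,
which identifies its two sides with each other, but neither its corners nor any triangles.) -/
inductive Identified : S.PieceCorner → S.PieceCorner → Prop
  | glue_middle {t i t' p} (h : T.glue t i = some (t', p)) {v : Fin 4} (hv : v ≠ i) :
      Identified (.middle t i v hv) (.middle t' (p i) (p v) (p.injective.ne hv))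
  | glue_corner {t i t' p} (h : T.glue t i = some (t', p)) {v : Fin 4} (hv : v ≠ i)
      (k : Fin (S.arcs t i v)) (far : Bool) :
      Identified (.corner t i v hv k far)
        (.corner t' (p i) (p v) (p.injective.ne hv) (Fin.cast (S.matching h hv) k) far)
  | flatten {x y : S.PieceCorner} {c : S.Cell} (hc : ¬ c.IsTetrahedron)
      (hx : S.IsFace x.piece c) (hy : S.IsFace y.piece c)
      (hxy : x.piece.vertices = y.piece.vertices) (h : x.point = y.point) :
      Identified x y

/-- The tetrahedra of the crushed triangulation: the cells that collapse to tetrahedra. -/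
abbrev TetCell : Type _ := {c : S.Cell // c.IsTetrahedron}

/-- `T'` is the triangulation obtained by crushing along `S`: its tetrahedra are the tetrahedral
cells left after cutting and collapsing, and two different triangular faces of them are glued
together, by a given bijection of their vertices, exactly if flattening (with the original gluings)
identifies them in this way. Any other identification of vertices or edges is undone, as only the
gluings of triangular faces are kept; this separates tetrahedra joined by pinched vertices and
edges. Face `i` of a tetrahedral cell is the middle piece of face `i` of the tetrahedron that
contains it. -/
def IsCrushing (T' : GenTriangulation S.TetCell) : Prop :=
  ∀ (c : S.TetCell) (i : Fin 4) (d : S.TetCell) (p : Equiv.Perm (Fin 4)),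
    T'.glue c i = some (d, p) ↔
      (d, p i) ≠ (c, i) ∧ ∀ (v : Fin 4) (hv : v ≠ i),
        Relation.EqvGen S.Identified (.middle c.1.tet i v hv)
          (.middle d.1.tet (p i) (p v) (p.injective.ne hv))

end NormalSurface

/-! ## Immersions of graphs -/

namespace Graph

variable {α β α' β' : Type*}

/-- The graph obtained by removing the two arcs `e` and `f` and adding an arc from `u` to `w`,
which takes over the label `e`. -/
def replaceArcs (G : Graph α β) (e f : β) {u w : α} (hu : u ∈ G.vertexSet)
    (hw : w ∈ G.vertexSet) : Graph α β where
  vertexSet := G.vertexSet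
  IsLink a x y := (a ≠ e ∧ a ≠ f ∧ G.IsLink a x y) ∨ (a = e ∧ s(x, y) = s(u, w))
  isLink_symm := by
    intro a _
    refine ⟨?_⟩
    rintro x y (⟨h₁, h₂, h⟩ | ⟨h₁, h⟩)
    · exact Or.inl ⟨h₁, h₂, h.symm⟩
    · exact Or.inr ⟨h₁, by rw [Sym2.eq_swap, h]⟩
  eq_or_eq_of_isLink_of_isLink := by
    rintro a x y v z (⟨h₁, h₂, h⟩ | ⟨h₁, h⟩) (⟨h₁', h₂', h'⟩ | ⟨h₁', h'⟩)
    · exact h.left_eq_or_eq h'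
    · exact absurd h₁' h₁
    · exact absurd h₁ h₁'
    · rw [← h'] at h
      simp only [Sym2.eq_iff] at h
      tauto
  left_mem_of_isLink := by
    rintro a x y (⟨-, -, h⟩ | ⟨-, h⟩)
    · exact h.left_mem
    · simp only [Sym2.eq_iff] at h
      rcases h with ⟨rfl, -⟩ | ⟨rfl, -⟩ <;> assumption

/-- One step of an immersion: a lifting of two adjacent arcs, or the removal of an arc, or
the removal of a node together with the arcs incident to it. -/
inductive ImmersionStep : Graph α β → Graph α β → Prop
  | lifting (G : Graph α β) {e f : β} {u v w : α} (hef : e ≠ f) (he : G.IsLink e u v)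
      (hf : G.IsLink f v w) : ImmersionStep G (G.replaceArcs e f he.left_mem hf.right_mem)
  | removeArc (G : Graph α β) {e : β} (he : e ∈ G.edgeSet) : ImmersionStep G (G.deleteEdges {e})
  | removeNode (G : Graph α β) {v : α} (hv : v ∈ G.vertexSet) : ImmersionStep G (G.deleteVerts {v})

/-- Isomorphism of graphs with loops and multiple arcs. -/
def IsIsomorphic (G : Graph α β) (H : Graph α' β') : Prop :=
  ∃ (φ : G.vertexSet ≃ H.vertexSet) (ψ : G.edgeSet ≃ H.edgeSet), ∀ e x y,
    G.IsLink e.1 x.1 y.1 ↔ H.IsLink (ψ e).1 (φ x).1 (φ y).1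

/-- `H.IsImmersionOf G`: the graph `H` is, up to isomorphism, obtained from `G` by a finite sequence
of liftings and removals of arcs and nodes. -/
def IsImmersionOf (H : Graph α' β') (G : Graph α β) : Prop :=
  ∃ K : Graph α β, Relation.ReflTransGen ImmersionStep G K ∧ K.IsIsomorphic H

end Graph

/-! Only purses affect the gluing of triangles: a football has bigons as faces, and a bigon, with at
most two vertices, never shares its vertex set with a triangle, whose three corners stay distinct.
So crushing is encoded on the faces `(t, i)` of the original tetrahedra by two relations: the
partial matching `GluedFaces`, and the involution `flipFace` that exchanges the two triangles of
each purse and fixes exactly the faces of the tetrahedra without quads.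

Alternating between a partial matching and an involution traces paths and cycles, and a fixed point
of the involution can only be an end of a path. Hence each class of the generated equivalence
relation contains at most two fixed points (`IsPartialMatching.isPairing_orbitRel`). Applied to
faces and also to their corners, this shows that the surviving faces are glued in pairs by unique
maps (`IsGluing.unique`).

For the immersion, the two-element orbits of the involution are treated one at a time
(`involution_induction`). Such an orbit consists of two faces of one tetrahedron, so flattening one
purse either splices two different arcs at a common node, which is a lifting, or only destroys arcs,
which is a removal (`ReducesTo.joinClasses`). After all purses are flattened, the nodes of the
tetrahedra with quads carry no arcs and are deleted. -/

/-! ## Pairings -/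

/-- The relation obtained from an equivalence relation by joining the classes of `a` and `b`. -/
def joinClasses {Y : Type*} (r : Y → Y → Prop) (a b x y : Y) : Prop :=
  r x y ∨ (r x a ∧ r b y) ∨ (r x b ∧ r a y)

/-- An equivalence relation `r` each of whose classes contains at most two elements of `U`. -/
structure IsPairing {Y : Type*} (r : Y → Y → Prop) (U : Set Y) : Prop where
  equiv : Equivalence r
  at_most_two : ∀ {x y z}, x ∈ U → y ∈ U → z ∈ U → r x y → r x z → x = y ∨ x = z ∨ y = z

/-- Two different elements of `U` in the same class. -/
def Matched {Y : Type*} (r : Y → Y → Prop) (U : Set Y) (a b : Y) : Prop :=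
  a ∈ U ∧ b ∈ U ∧ a ≠ b ∧ r a b

section Pairing

variable {Y : Type*} {r : Y → Y → Prop} {U : Set Y} {a b : Y}

theorem Matched.symm (hr : Equivalence r) (h : Matched r U a b) : Matched r U b a :=
  ⟨h.2.1, h.1, h.2.2.1.symm, hr.symm h.2.2.2⟩

theorem equivalence_joinClasses (hr : Equivalence r) (a b : Y) :
    Equivalence (joinClasses r a b) where
  refl x := Or.inl (hr.refl x)
  symm := by
    rintro x y (h | ⟨h, h'⟩ | ⟨h, h'⟩)
    · exact Or.inl (hr.symm h)
    · exact Or.inr (Or.inr ⟨hr.symm h', hr.symm h⟩)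
    · exact Or.inr (Or.inl ⟨hr.symm h', hr.symm h⟩)
  trans := by
    have hs := @hr.symm
    have ht := @hr.trans
    rintro x y z (h | ⟨h, h'⟩ | ⟨h, h'⟩) (k | ⟨k, k'⟩ | ⟨k, k'⟩)
    · exact Or.inl (ht h k)
    · exact Or.inr (Or.inl ⟨ht h k, k'⟩)
    · exact Or.inr (Or.inr ⟨ht h k, k'⟩)
    · exact Or.inr (Or.inl ⟨h, ht h' k⟩)
    · exact Or.inr (Or.inl ⟨h, k'⟩)
    · exact Or.inl (ht h k')
    · exact Or.inr (Or.inr ⟨h, ht h' k⟩)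
    · exact Or.inl (ht h k')
    · exact Or.inr (Or.inr ⟨h, k'⟩)

/-- Each of the two classes has at most one element of `U` besides `a` or `b`, so at most two remain
in their union. -/
theorem IsPairing.joinClasses (h : IsPairing r U) (ha : a ∈ U) (hb : b ∈ U) :
    IsPairing (joinClasses r a b) (U \ {a, b}) where
  equiv := equivalence_joinClasses h.equiv a b
  at_most_two := by
    have hs := @h.equiv.symm
    have ht := @h.equiv.trans
    rintro x y z ⟨hx, hx'⟩ ⟨hy, hy'⟩ ⟨hz, hz'⟩ hxy hxz
    simp only [Set.mem_insert_iff, Set.mem_singleton_iff, not_or] at hx' hy' hz'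
    have key : ∀ {c x y}, c ∈ U → x ∈ U → y ∈ U → x ≠ c → y ≠ c → r x c → r y c → x = y := by
      intro c x y hc hx hy hxc hyc h1 h2
      rcases h.at_most_two hc hx hy (hs h1) (hs h2) with e | e | e
      · exact absurd e.symm hxc
      · exact absurd e.symm hyc
      · exact e
    rcases hxy with h1 | ⟨h1, h2⟩ | ⟨h1, h2⟩ <;> rcases hxz with k1 | ⟨k1, k2⟩ | ⟨k1, k2⟩
    · exact h.at_most_two hx hy hz h1 k1
    · exact Or.inl (key ha hx hy hx'.1 hy'.1 k1 (ht (hs h1) k1))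
    · exact Or.inl (key hb hx hy hx'.2 hy'.2 k1 (ht (hs h1) k1))
    · exact Or.inr (Or.inl (key ha hx hz hx'.1 hz'.1 h1 (ht (hs k1) h1)))
    · exact Or.inr (Or.inr (key hb hy hz hy'.2 hz'.2 (hs h2) (hs k2)))
    · exact Or.inr (Or.inl (key ha hx hz hx'.1 hz'.1 h1 (hs k2)))
    · exact Or.inr (Or.inl (key hb hx hz hx'.2 hz'.2 h1 (ht (hs k1) h1)))
    · exact Or.inl (key ha hx hy hx'.1 hy'.1 k1 (hs h2))
    · exact Or.inr (Or.inr (key ha hy hz hy'.1 hz'.1 (hs h2) (hs k2)))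

/-! ### Adding the orbits of an involution to an equivalence relation -/

/-- The equivalence relation generated by a relation `s` and a map `f`. -/
def orbitRel (s : Y → Y → Prop) (f : Y → Y) : Y → Y → Prop :=
  Relation.EqvGen fun x y => s x y ∨ f x = y

theorem equivalence_orbitRel (s : Y → Y → Prop) (f : Y → Y) : Equivalence (orbitRel s f) :=
  Relation.EqvGen.is_equivalence _

theorem orbitRel_of_rel {s : Y → Y → Prop} (f : Y → Y) {x y : Y} (h : s x y) : orbitRel s f x y :=
  .rel _ _ (Or.inl h)

theorem orbitRel_apply (s : Y → Y → Prop) (f : Y → Y) (x : Y) : orbitRel s f x (f x) :=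
  .rel _ _ (Or.inr rfl)

/-- An involution changed so as to fix `a` and `f a`. -/
def fixPair [DecidableEq Y] (f : Y → Y) (a x : Y) : Y := if x = a ∨ x = f a then x else f x

theorem fixPair_involutive [DecidableEq Y] {f : Y → Y} (hf : Function.Involutive f) (a : Y) :
    Function.Involutive (fixPair f a) := by
  intro x
  by_cases h : x = a ∨ x = f a
  · simp [fixPair, h]
  · have h' : ¬ (f x = a ∨ f x = f a) := by
      rw [not_or] at h ⊢
      refine ⟨fun e => h.2 (by rw [← e, hf]), fun e => h.1 (hf.injective e)⟩
    simp [fixPair, h, h', hf x]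

theorem orbitRel_eq_joinClasses [DecidableEq Y] {s : Y → Y → Prop} {f : Y → Y}
    (hf : Function.Involutive f) (a : Y) :
    orbitRel s f = joinClasses (orbitRel s (fixPair f a)) a (f a) := by
  have he := equivalence_orbitRel s (fixPair f a)
  have hj := equivalence_joinClasses he a (f a)
  funext x y
  refine propext ⟨fun h => ?_, fun h => ?_⟩
  · induction h with
    | rel x y h =>
      rcases h with h | rfl
      · exact Or.inl (orbitRel_of_rel _ h)
      · by_cases h : x = a ∨ x = f a
        · rcases h with rfl | rfl
          · exact Or.inr (Or.inl ⟨he.refl _, he.refl _⟩)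
          · rw [hf]
            exact Or.inr (Or.inr ⟨he.refl _, he.refl _⟩)
        · have := orbitRel_apply s (fixPair f a) x
          rw [fixPair, if_neg h] at this
          exact Or.inl this
    | refl x => exact hj.refl x
    | symm x y _ ih => exact hj.symm ih
    | trans x y z _ _ ih ih' => exact hj.trans ih ih'
  · have hE := equivalence_orbitRel s f
    have mono : ∀ {x y}, orbitRel s (fixPair f a) x y → orbitRel s f x y := by
      intro x y h
      induction h with
      | rel x y h =>
        rcases h with h | rfl
        · exact orbitRel_of_rel _ h
        · unfold fixPair
          split_ifs
          · exact hE.refl _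
          · exact orbitRel_apply s f x
      | refl x => exact hE.refl x
      | symm x y _ ih => exact hE.symm ih
      | trans x y z _ _ ih ih' => exact hE.trans ih ih'
    rcases h with h | ⟨h, h'⟩ | ⟨h, h'⟩
    · exact mono h
    · exact hE.trans (mono h) (hE.trans (orbitRel_apply s f a) (mono h'))
    · exact hE.trans (mono h) (hE.trans (hE.symm (orbitRel_apply s f a)) (mono h'))

theorem fixedPoints_eq_diff [DecidableEq Y] {f : Y → Y} (hf : Function.Involutive f) {a : Y}
    (ha : f a ≠ a) :
    Function.fixedPoints f = Function.fixedPoints (fixPair f a) \ {a, f a} := by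
  ext x
  simp only [Function.mem_fixedPoints, Function.IsFixedPt, Set.mem_sdiff, Set.mem_insert_iff,
    Set.mem_singleton_iff, fixPair]
  by_cases h : x = a ∨ x = f a
  · simp only [h, if_true, not_true_eq_false, and_false, iff_false]
    rcases h with rfl | rfl
    · exact ha
    · rw [hf]
      exact ha.symm
  · simp [h]

/-- Induction on an involution `f` of a finite type, one two-element orbit of `f` at a time. -/
theorem involution_induction [Finite Y] {s : Y → Y → Prop}
    {C : (Y → Y → Prop) → Set Y → Prop} {rel : Y → Y → Prop}
    (base : C (Relation.EqvGen s) Set.univ)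
    (step : ∀ r U a b, C r U → a ∈ U → b ∈ U → rel a b →
      C (joinClasses r a b) (U \ {a, b}))
    {f : Y → Y} (hf : Function.Involutive f) (hrel : ∀ x, rel x (f x)) :
    C (orbitRel s f) (Function.fixedPoints f) := by
  classical
  -- The induction is on the number of points moved by `f`, which decreases on passing to `fixPair f
  -- a`. Only moved points are required to satisfy `rel`, because `fixPair` creates new fixed points
  -- and `rel` need not be reflexive.
  suffices H : ∀ n : ℕ, ∀ f : Y → Y, Function.Involutive f → (∀ x, f x ≠ x → rel x (f x)) →
      (Function.fixedPoints f)ᶜ.ncard = n → C (orbitRel s f) (Function.fixedPoints f) from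
    H _ f hf (fun x _ => hrel x) rfl
  intro n
  induction n using Nat.strong_induction_on with
  | _ n ih =>
    intro f hf hrel hn
    by_cases h : ∃ a, f a ≠ a
    · obtain ⟨a, ha⟩ := h
      rw [orbitRel_eq_joinClasses hf a, fixedPoints_eq_diff hf ha]
      have hfix : a ∈ Function.fixedPoints (fixPair f a) ∧
          f a ∈ Function.fixedPoints (fixPair f a) := by
        simp [Function.mem_fixedPoints, Function.IsFixedPt, fixPair]
      refine step _ _ _ _ (ih _ ?_ _ (fixPair_involutive hf a) ?_ rfl) hfix.1 hfix.2
        (hrel a ha)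
      · rw [← hn]
        refine Set.ncard_lt_ncard ?_ (Set.toFinite _)
        rw [fixedPoints_eq_diff hf ha]
        exact ⟨fun x hx hx' => hx hx'.1, fun h => h (fun h' => h'.2 (Or.inl rfl)) hfix.1⟩
      · intro x hx
        unfold fixPair at hx ⊢
        split_ifs with h
        · rw [if_pos h] at hx
          exact absurd rfl hx
        · rw [if_neg h] at hx
          exact hrel x hx
    · push Not at h
      obtain rfl : f = id := funext h
      have h1 : orbitRel s (id : Y → Y) = Relation.EqvGen s := by
        have hE := Relation.EqvGen.is_equivalence s
        funext x y
        refine propext ⟨fun h => ?_, Relation.EqvGen.mono (fun _ _ => Or.inl) x y⟩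
        induction h with
        | rel x y h =>
          rcases h with h | rfl
          · exact .rel _ _ h
          · exact hE.refl _
        | refl x => exact hE.refl x
        | symm x y _ ih => exact hE.symm ih
        | trans x y z _ _ ih ih' => exact hE.trans ih ih'
      rw [h1, Function.fixedPoints_id]
      exact base

/-! ### Partial matchings -/

/-- A symmetric relation that relates each element to at most one element. -/
structure IsPartialMatching (s : Y → Y → Prop) : Prop where
  symm : ∀ {x y}, s x y → s y x
  unique : ∀ {x y z}, s x y → s x z → y = z

theorem IsPartialMatching.eqvGen_iff {s : Y → Y → Prop} (hs : IsPartialMatching s) {x y : Y} :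
    Relation.EqvGen s x y ↔ x = y ∨ s x y := by
  refine ⟨fun h => ?_, ?_⟩
  · induction h with
    | rel x y h => exact Or.inr h
    | refl x => exact Or.inl rfl
    | symm x y _ ih => exact ih.imp Eq.symm hs.symm
    | trans x y z _ _ ih ih' =>
      rcases ih with rfl | ih
      · exact ih'
      · rcases ih' with rfl | ih'
        · exact Or.inr ih
        · exact Or.inl (hs.unique (hs.symm ih) ih')
  · rintro (rfl | h)
    · exact .refl _
    · exact .rel _ _ h

theorem IsPartialMatching.isPairing {s : Y → Y → Prop} (hs : IsPartialMatching s) :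
    IsPairing (Relation.EqvGen s) Set.univ where
  equiv := Relation.EqvGen.is_equivalence s
  at_most_two := by
    intro x y z _ _ _ hxy hxz
    rw [hs.eqvGen_iff] at hxy hxz
    rcases hxy with h | h
    · exact Or.inl h
    · rcases hxz with h' | h'
      · exact Or.inr (Or.inl h')
      · exact Or.inr (Or.inr (hs.unique h h'))

theorem IsPartialMatching.isPairing_orbitRel [Finite Y] {s : Y → Y → Prop}
    (hs : IsPartialMatching s) {f : Y → Y} (hf : Function.Involutive f) :
    IsPairing (orbitRel s f) (Function.fixedPoints f) :=
  involution_induction (C := IsPairing) (rel := fun _ _ => True) hs.isPairing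
    (fun _ _ _ _ h ha hb _ => h.joinClasses ha hb) hf fun _ => trivial

end Pairing

/-! ## Graphs represented by pairings -/

namespace Graph

variable {α β Y : Type*}

/-- The arcs of the graph `G` are the pairs of matched elements of `U`, where the elements `a` of
`Y` are attached to the nodes `π a`, and `l a` is the label of the arc that contains `a`. -/
structure IsRepresentedBy (G : Graph α β) (π : Y → α) (r : Y → Y → Prop) (U : Set Y)
    (l : Y → β) : Prop where
  isLink_iff : ∀ {e x y}, G.IsLink e x y ↔ ∃ a b, Matched r U a b ∧ π a = x ∧ π b = y ∧ l a = e
  label_eq_iff : ∀ {a b a' b'}, Matched r U a a' → Matched r U b b' → (l a = l b ↔ r a b)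

/-- A graph with node set `V(G)` that is obtained from `G` by liftings and removals and
represented by the given pairing. -/
def ReducesTo (G : Graph α β) (π : Y → α) (r : Y → Y → Prop) (U : Set Y) : Prop :=
  ∃ (H : Graph α β) (l : Y → β), Relation.ReflTransGen ImmersionStep G H ∧
    H.vertexSet = G.vertexSet ∧ H.IsRepresentedBy π r U l

variable {G : Graph α β} {π : Y → α} {r : Y → Y → Prop} {U : Set Y} {l : Y → β}

theorem IsRepresentedBy.congr {r' : Y → Y → Prop} (h : G.IsRepresentedBy π r U l)
    (hr : ∀ a ∈ U, ∀ b ∈ U, r a b ↔ r' a b) : G.IsRepresentedBy π r' U l := by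
  have hM : ∀ a b, Matched r' U a b ↔ Matched r U a b := fun a b =>
    ⟨fun ⟨h1, h2, h3, h4⟩ => ⟨h1, h2, h3, (hr a h1 b h2).2 h4⟩,
      fun ⟨h1, h2, h3, h4⟩ => ⟨h1, h2, h3, (hr a h1 b h2).1 h4⟩⟩
  refine ⟨fun {e x y} => ?_, fun {a b a' b'} ha hb => ?_⟩
  · simpa only [hM] using h.isLink_iff (e := e) (x := x) (y := y)
  rw [hM] at ha hb
  rw [h.label_eq_iff ha hb, hr a ha.1 b hb.1]

theorem ReducesTo.congr {r' : Y → Y → Prop} (h : G.ReducesTo π r U)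
    (hr : ∀ a ∈ U, ∀ b ∈ U, r a b ↔ r' a b) : G.ReducesTo π r' U := by
  obtain ⟨H, l, h1, h2, h3⟩ := h
  exact ⟨H, l, h1, h2, h3.congr hr⟩

theorem matched_diff_iff {a x y : Y} :
    Matched r (U \ {a}) x y ↔ Matched r U x y ∧ x ≠ a ∧ y ≠ a := by
  simp only [Matched, Set.mem_sdiff, Set.mem_singleton_iff]
  tauto

/-- Removing an arc frees one of its ends. -/
theorem ReducesTo.diff_singleton (hp : IsPairing r U) (h : G.ReducesTo π r U) (a : Y) :
    G.ReducesTo π r (U \ {a}) := by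
  obtain ⟨H, l, h1, h2, h3⟩ := h
  by_cases ha : ∃ b, Matched r U a b
  · obtain ⟨b, hb⟩ := ha
    have he : l a ∈ H.edgeSet :=
      (H.edge_mem_iff_exists_isLink _).2 ⟨π a, π b, h3.isLink_iff.2 ⟨a, b, hb, rfl, rfl, rfl⟩⟩
    refine ⟨H.deleteEdges {l a}, l, h1.tail (.removeArc H he), by simpa using h2, ?_, ?_⟩
    · intro e x y
      have : (H.deleteEdges {l a}).IsLink e x y ↔ H.IsLink e x y ∧ e ≠ l a := by
        simp [deleteEdges_isLink]
      rw [this, h3.isLink_iff]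
      constructor
      · rintro ⟨⟨c, d, hcd, rfl, rfl, rfl⟩, hne⟩
        refine ⟨c, d, matched_diff_iff.2 ⟨hcd, ?_, ?_⟩, rfl, rfl, rfl⟩
        · rintro rfl
          exact hne rfl
        · rintro rfl
          exact hne ((h3.label_eq_iff hcd hb).2 hcd.2.2.2)
      · rintro ⟨c, d, hcd, rfl, rfl, rfl⟩
        obtain ⟨hcd, hc, hd⟩ := matched_diff_iff.1 hcd
        refine ⟨⟨c, d, hcd, rfl, rfl, rfl⟩, fun e => ?_⟩
        have hca := (h3.label_eq_iff hcd hb).1 e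
        rcases hp.at_most_two hcd.1 hb.1 hcd.2.1 hca hcd.2.2.2 with e | e | e
        · exact hc e
        · exact hcd.2.2.1 e
        · exact hd e.symm
    · intro c d c' d' hc hd
      exact h3.label_eq_iff (matched_diff_iff.1 hc).1 (matched_diff_iff.1 hd).1
  -- If `a` is unmatched, no arc ends there and `H` itself still works.
  · have key : ∀ x y, Matched r (U \ {a}) x y ↔ Matched r U x y := by
      intro x y
      rw [matched_diff_iff]
      refine ⟨fun h => h.1, fun h => ⟨h, ?_, ?_⟩⟩
      · rintro rfl
        exact ha ⟨y, h⟩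
      · rintro rfl
        exact ha ⟨x, h.symm hp.equiv⟩
    refine ⟨H, l, h1, h2, fun {e x y} => ?_, fun hc hd => ?_⟩
    · simpa only [key] using h3.isLink_iff (e := e) (x := x) (y := y)
    rw [key] at hc hd
    exact h3.label_eq_iff hc hd

theorem IsPairing.diff (hp : IsPairing r U) (A : Set Y) : IsPairing r (U \ A) :=
  ⟨hp.equiv, fun hx hy hz => hp.at_most_two hx.1 hy.1 hz.1⟩

/-- Joining two classes that each contain two elements of `U` lifts the corresponding arcs. -/
theorem ReducesTo.lift (hp : IsPairing r U) (h : G.ReducesTo π r U) {a a' b b' : Y}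
    (hr : ¬ r a a') (hπ : π a = π a') (hb : Matched r U a b) (hb' : Matched r U a' b') :
    G.ReducesTo π (joinClasses r a a') (U \ {a, a'}) := by
  classical
  obtain ⟨H, l, h1, h2, h3⟩ := h
  have hs := @hp.equiv.symm
  have ht := @hp.equiv.trans
  have hr0 := hp.equiv.refl
  have hbU := hb.2.1
  have hbU' := hb'.2.1
  have rab := hb.2.2.2
  have rab' := hb'.2.2.2
  have classA : ∀ {x}, x ∈ U → r x a → x = a ∨ x = b := by
    intro x hx hxa
    rcases hp.at_most_two hb.1 hb.2.1 hx rab (hs hxa) with e | e | e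
    · exact absurd e hb.2.2.1
    · exact Or.inl e.symm
    · exact Or.inr e.symm
  have classA' : ∀ {x}, x ∈ U → r x a' → x = a' ∨ x = b' := by
    intro x hx hxa
    rcases hp.at_most_two hb'.1 hb'.2.1 hx rab' (hs hxa) with e | e | e
    · exact absurd e hb'.2.2.1
    · exact Or.inl e.symm
    · exact Or.inr e.symm
  have hba' : b ≠ a' := fun e => hr (e ▸ rab)
  have hb'a : b' ≠ a := fun e => hr (hs (e ▸ rab'))
  have hbb' : b ≠ b' := fun e => hr (ht rab (e ▸ hs rab'))
  have hef : l a ≠ l a' := fun e => hr ((h3.label_eq_iff hb hb').1 e)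
  -- The arcs to lift run from `π b` to `π a` and from `π a = π a'` to `π b'`.
  have he : H.IsLink (l a) (π b) (π a) :=
    (h3.isLink_iff.2 ⟨a, b, hb, rfl, rfl, rfl⟩).symm
  have hf : H.IsLink (l a') (π a) (π b') := h3.isLink_iff.2 ⟨a', b', hb', hπ.symm, rfl, rfl⟩
  have hMb : Matched (joinClasses r a a') (U \ {a, a'}) b b' :=
    ⟨⟨hbU, by simp [hb.2.2.1.symm, hba']⟩, ⟨hbU', by simp [hb'.2.2.1.symm, hb'a]⟩, hbb',
      Or.inr (Or.inl ⟨hs rab, rab'⟩)⟩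
  -- The new matched pairs are `b, b'` in either order and the old pairs outside the two joined
  -- classes.
  have hMiff : ∀ {x y}, Matched (joinClasses r a a') (U \ {a, a'}) x y ↔
      (x = b ∧ y = b') ∨ (x = b' ∧ y = b) ∨ (Matched r U x y ∧ ¬ r x a ∧ ¬ r x a') := by
    intro x y
    constructor
    · rintro ⟨⟨hx, hx'⟩, ⟨hy, hy'⟩, hxy, hxy'⟩
      simp only [Set.mem_insert_iff, Set.mem_singleton_iff, not_or] at hx' hy'
      rcases hxy' with k | ⟨k, k'⟩ | ⟨k, k'⟩
      · refine Or.inr (Or.inr ⟨⟨hx, hy, hxy, k⟩, fun k' => ?_, fun k' => ?_⟩)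
        · exact hxy (((classA hx k').resolve_left hx'.1).trans
            ((classA hy (ht (hs k) k')).resolve_left hy'.1).symm)
        · exact hxy (((classA' hx k').resolve_left hx'.2).trans
            ((classA' hy (ht (hs k) k')).resolve_left hy'.2).symm)
      · exact Or.inl ⟨(classA hx k).resolve_left hx'.1, (classA' hy (hs k')).resolve_left hy'.2⟩
      · exact Or.inr (Or.inl ⟨(classA' hx k).resolve_left hx'.2,
          (classA hy (hs k')).resolve_left hy'.1⟩)
    · rintro (⟨rfl, rfl⟩ | ⟨rfl, rfl⟩ | ⟨⟨hx, hy, hxy, hxy'⟩, k, k'⟩)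
      · exact hMb
      · exact hMb.symm (equivalence_joinClasses hp.equiv a a')
      · refine ⟨⟨hx, ?_⟩, ⟨hy, ?_⟩, hxy, Or.inl hxy'⟩
        · rintro (rfl | rfl)
          · exact k (hr0 _)
          · exact k' (hr0 _)
        · rintro (rfl | rfl)
          · exact k hxy'
          · exact k' hxy'
  have lb : l b = l a := (h3.label_eq_iff (hb.symm hp.equiv) hb).2 (hs rab)
  -- The lifted arc keeps the label `l a`, which `b` already has; only `b'`, formerly labelled `l
  -- a'`, must be relabelled.
  set l' := Function.update l b' (l a) with hl'
  have l'b' : l' b' = l a := by simp [hl']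
  have l'b : l' b = l a := by rw [hl', Function.update_of_ne hbb', lb]
  have l'o : ∀ {x}, ¬ r x a' → l' x = l x := fun {x} k => by
    rw [hl', Function.update_of_ne]
    rintro rfl
    exact k (hs rab')
  refine ⟨H.replaceArcs (l a) (l a') he.left_mem hf.right_mem, l',
    h1.tail (.lifting H hef he hf), h2, ?_, ?_⟩
  · intro e x y
    change ((e ≠ l a ∧ e ≠ l a' ∧ H.IsLink e x y) ∨ (e = l a ∧ s(x, y) = s(π b, π b'))) ↔ _
    constructor
    · rintro (⟨n1, n2, hl⟩ | ⟨rfl, hxy⟩)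
      · obtain ⟨c, d, hcd, rfl, rfl, rfl⟩ := h3.isLink_iff.1 hl
        have k1 : ¬ r c a := fun k => n1 ((h3.label_eq_iff hcd hb).2 k)
        have k2 : ¬ r c a' := fun k => n2 ((h3.label_eq_iff hcd hb').2 k)
        exact ⟨c, d, hMiff.2 (Or.inr (Or.inr ⟨hcd, k1, k2⟩)), rfl, rfl, l'o k2⟩
      · rcases Sym2.eq_iff.1 hxy with ⟨rfl, rfl⟩ | ⟨rfl, rfl⟩
        · exact ⟨b, b', hMb, rfl, rfl, l'b⟩
        · exact ⟨b', b, hMiff.2 (Or.inr (Or.inl ⟨rfl, rfl⟩)), rfl, rfl, l'b'⟩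
    · rintro ⟨c, d, hcd, rfl, rfl, rfl⟩
      rcases hMiff.1 hcd with ⟨rfl, rfl⟩ | ⟨rfl, rfl⟩ | ⟨hcd, k, k'⟩
      · exact Or.inr ⟨l'b, rfl⟩
      · exact Or.inr ⟨l'b', Sym2.eq_swap⟩
      · rw [l'o k']
        exact Or.inl ⟨fun e => k ((h3.label_eq_iff hcd hb).1 e),
          fun e => k' ((h3.label_eq_iff hcd hb').1 e),
          h3.isLink_iff.2 ⟨c, d, hcd, rfl, rfl, rfl⟩⟩
  · intro c d c' d' hc hd
    have cls : ∀ {c c'}, Matched (joinClasses r a a') (U \ {a, a'}) c c' →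
        (joinClasses r a a' c a ∧ l' c = l a) ∨
          (Matched r U c c' ∧ ¬ r c a ∧ ¬ r c a' ∧ l' c = l c ∧ l c ≠ l a) := by
      intro c c' hc
      rcases hMiff.1 hc with ⟨rfl, rfl⟩ | ⟨rfl, rfl⟩ | ⟨hc, k, k'⟩
      · exact Or.inl ⟨Or.inl (hs rab), l'b⟩
      · exact Or.inl ⟨Or.inr (Or.inr ⟨hs rab', hr0 a⟩), l'b'⟩
      · exact Or.inr ⟨hc, k, k', l'o k', fun e => k ((h3.label_eq_iff hc hb).1 e)⟩
    have hj := equivalence_joinClasses hp.equiv a a'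
    rcases cls hc with ⟨c1, c2⟩ | ⟨c0, c1, c2, c3, c4⟩ <;>
      rcases cls hd with ⟨d1, d2⟩ | ⟨d0, d1, d2, d3, d4⟩
    · exact iff_of_true (c2.trans d2.symm) (hj.trans c1 (hj.symm d1))
    · refine iff_of_false (fun e => d4 (by rw [← d3, ← e, c2])) fun k => ?_
      rcases hj.trans (hj.symm k) c1 with k | ⟨k, -⟩ | ⟨k, -⟩
      exacts [d1 k, d1 k, d2 k]
    · refine iff_of_false (fun e => c4 (by rw [← c3, e, d2])) fun k => ?_
      rcases hj.trans k d1 with k | ⟨k, -⟩ | ⟨k, -⟩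
      exacts [c1 k, c1 k, c2 k]
    · rw [c3, d3, h3.label_eq_iff c0 d0]
      refine ⟨Or.inl, ?_⟩
      rintro (k | ⟨k, -⟩ | ⟨k, -⟩)
      exacts [k, absurd k c1, absurd k c2]

/-- If `a` and `b` end two different arcs, these are lifted. Otherwise they end the same loop, or
one of them is free; then joining the classes relates no new elements of `U \ {a, b}`, and removing
the arcs at `a` and `b` suffices. -/
theorem ReducesTo.joinClasses (hp : IsPairing r U) (h : G.ReducesTo π r U) {a b : Y}
    (ha : a ∈ U) (hb : b ∈ U) (hπ : π a = π b) :
    G.ReducesTo π (joinClasses r a b) (U \ {a, b}) := by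
  have hs := @hp.equiv.symm
  have ht := @hp.equiv.trans
  by_cases hcase : ¬ r a b ∧ (∃ c, Matched r U a c) ∧ ∃ d, Matched r U b d
  · obtain ⟨hr, ⟨c, hc⟩, ⟨d, hd⟩⟩ := hcase
    exact h.lift hp hr hπ hc hd
  · have h' : G.ReducesTo π r (U \ {a, b}) := by
      have := (h.diff_singleton hp a).diff_singleton (IsPairing.diff hp {a}) b
      rwa [Set.sdiff_sdiff, Set.singleton_union] at this
    refine h'.congr ?_
    rintro x ⟨hx, hx'⟩ y ⟨hy, hy'⟩
    simp only [Set.mem_insert_iff, Set.mem_singleton_iff, not_or] at hx' hy'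
    refine ⟨Or.inl, fun k => ?_⟩
    by_cases hr : r a b
    · rcases k with k | ⟨k, k'⟩ | ⟨k, k'⟩
      · exact k
      · exact ht k (ht hr k')
      · exact ht k (ht (hs hr) k')
    · rcases k with k | ⟨k, k'⟩ | ⟨k, k'⟩
      · exact k
      · exact absurd ⟨hr, ⟨x, ha, hx, Ne.symm hx'.1, hs k⟩, ⟨y, hb, hy, Ne.symm hy'.2, k'⟩⟩ hcase
      · exact absurd ⟨hr, ⟨y, ha, hy, Ne.symm hy'.1, k'⟩, ⟨x, hb, hx, Ne.symm hx'.2, hs k⟩⟩ hcase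

/-- Nodes can be removed one by one. -/
theorem reflTransGen_deleteVerts (G : Graph α β) {A : Set α} (hA : A.Finite)
    (hAG : A ⊆ G.vertexSet) : Relation.ReflTransGen ImmersionStep G (G.deleteVerts A) := by
  induction A, hA using Set.Finite.induction_on with
  | empty => rw [deleteVerts_empty]
  | @insert v A hv _ ih =>
    have hAG' := Set.insert_subset_iff.1 hAG
    refine (ih hAG'.2).tail ?_
    have : G.deleteVerts (insert v A) = (G.deleteVerts A).deleteVerts {v} := by
      refine Graph.ext ?_ ?_
      · ext x
        simp only [vertexSet_deleteVerts, Set.mem_sdiff, Set.mem_insert_iff, Set.mem_singleton_iff]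
        tauto
      · intro e x y
        simp only [deleteVerts_isLink, Set.mem_insert_iff, Set.mem_singleton_iff]
        tauto
    rw [this]
    exact .removeNode _ (by simpa using ⟨hAG'.1, hv⟩)

/-- Two graphs whose arcs come from the same matching are isomorphic. -/
theorem isIsomorphic_of_matching {α' β' : Type*} {H : Graph α' β'} {M : Y → Y → Prop}
    {π : Y → α'} {l : Y → β} {l' : Y → β'} {φ : α' → α} (hφ : Function.Injective φ)
    (hG : G.vertexSet = Set.range φ) (hH : H.vertexSet = Set.univ)
    (hGl : ∀ e x y, G.IsLink e x y ↔ ∃ a b, M a b ∧ φ (π a) = x ∧ φ (π b) = y ∧ l a = e)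
    (hHl : ∀ e x y, H.IsLink e x y ↔ ∃ a b, M a b ∧ π a = x ∧ π b = y ∧ l' a = e)
    (hl : ∀ a b c d, M a b → M c d → (l a = l c ↔ l' a = l' c)) : G.IsIsomorphic H := by
  have hGe : ∀ e, e ∈ G.edgeSet ↔ ∃ a b, M a b ∧ l a = e := fun e => by
    rw [G.edge_mem_iff_exists_isLink]
    simp only [hGl]
    exact ⟨fun ⟨_, _, a, b, h, _, _, h'⟩ => ⟨a, b, h, h'⟩,
      fun ⟨a, b, h, h'⟩ => ⟨_, _, a, b, h, rfl, rfl, h'⟩⟩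
  have hHe : ∀ e, e ∈ H.edgeSet ↔ ∃ a b, M a b ∧ l' a = e := fun e => by
    rw [H.edge_mem_iff_exists_isLink]
    simp only [hHl]
    exact ⟨fun ⟨_, _, a, b, h, _, _, h'⟩ => ⟨a, b, h, h'⟩,
      fun ⟨a, b, h, h'⟩ => ⟨_, _, a, b, h, rfl, rfl, h'⟩⟩
  let φ' : H.vertexSet ≃ G.vertexSet := Equiv.ofBijective
    (fun x => ⟨φ x.1, by rw [hG]; exact ⟨_, rfl⟩⟩)
    ⟨fun x y h => Subtype.ext (hφ (congrArg Subtype.val h)), fun ⟨y, hy⟩ => by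
      rw [hG] at hy
      obtain ⟨x, rfl⟩ := hy
      exact ⟨⟨x, by rw [hH]; trivial⟩, rfl⟩⟩
  have hF : ∀ e : G.edgeSet, ∃ e' : H.edgeSet, ∃ a b, M a b ∧ l a = e.1 ∧ l' a = e'.1 := by
    rintro ⟨e, he⟩
    obtain ⟨a, b, h, rfl⟩ := (hGe e).1 he
    exact ⟨⟨l' a, (hHe _).2 ⟨a, b, h, rfl⟩⟩, a, b, h, rfl, rfl⟩
  choose F fa fb hM h1 h2 using hF
  let ψ : G.edgeSet ≃ H.edgeSet := Equiv.ofBijective F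
    ⟨fun e e' h => Subtype.ext (by
      rw [← h1, ← h1, hl _ _ _ _ (hM e) (hM e'), h2, h2, h]), fun ⟨e', he'⟩ => by
      obtain ⟨a, b, h, rfl⟩ := (hHe e').1 he'
      refine ⟨⟨l a, (hGe _).2 ⟨a, b, h, rfl⟩⟩, Subtype.ext ?_⟩
      rw [← h2, ← hl _ _ _ _ (hM _) h, h1]⟩
  refine ⟨φ'.symm, ψ, fun e x y => ?_⟩
  obtain ⟨x, rfl⟩ := φ'.surjective x
  obtain ⟨y, rfl⟩ := φ'.surjective y
  rw [Equiv.symm_apply_apply, Equiv.symm_apply_apply, hGl, hHl]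
  change (∃ a b, M a b ∧ φ (π a) = φ x.1 ∧ φ (π b) = φ y.1 ∧ l a = e.1) ↔
    ∃ a b, M a b ∧ π a = x.1 ∧ π b = y.1 ∧ l' a = (F e).1
  simp only [hφ.eq_iff]
  refine exists_congr fun a => exists_congr fun b => and_congr_right fun hab =>
    and_congr_right fun _ => and_congr_right fun _ => ?_
  rw [← h1 e, ← h2 e]
  exact hl _ _ _ _ hab (hM e)

end Graph

/-! ## Faces and corners of a triangulation -/

namespace GenTriangulation

variable {ι : Type*} (T : GenTriangulation ι)

/-- Two faces are glued together. -/
def GluedFaces (x y : ι × Fin 4) : Prop :=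
  ∃ p, T.glue x.1 x.2 = some (y.1, p) ∧ p x.2 = y.2

/-- `(t, i, v)` stands for the corner `v` of the face `i` of `t`, or for the face itself
if `v = i`. Two such corners are glued together. -/
def GluedCorners (x y : ι × Fin 4 × Fin 4) : Prop :=
  ∃ p, T.glue x.1 x.2.1 = some (y.1, p) ∧ p x.2.1 = y.2.1 ∧ p x.2.2 = y.2.2

theorem isPartialMatching_gluedFaces : IsPartialMatching T.GluedFaces where
  symm := by
    rintro ⟨t, i⟩ ⟨t', j⟩ ⟨p, h, hp⟩
    obtain rfl : p i = j := hp
    exact ⟨p⁻¹, T.glue_symm h, by simp⟩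
  unique := by
    rintro ⟨t, i⟩ ⟨t', j⟩ ⟨t'', k⟩ ⟨p, h, hp⟩ ⟨p', h', hp'⟩
    rw [h] at h'
    simp only [Option.some.injEq, Prod.mk.injEq] at h' hp hp' ⊢
    obtain ⟨rfl, rfl⟩ := h'
    exact ⟨rfl, hp.symm.trans hp'⟩

theorem isPartialMatching_gluedCorners : IsPartialMatching T.GluedCorners where
  symm := by
    rintro ⟨t, i, v⟩ ⟨t', j, w⟩ ⟨p, h, hp, hp'⟩
    obtain rfl : p i = j := hp
    obtain rfl : p v = w := hp'
    exact ⟨p⁻¹, T.glue_symm h, by simp, by simp⟩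
  unique := by
    rintro ⟨t, i, v⟩ ⟨t', j, w⟩ ⟨t'', j', w'⟩ ⟨p, h, hp, hv⟩ ⟨p', h', hp', hv'⟩
    rw [h] at h'
    simp only [Option.some.injEq, Prod.mk.injEq] at h' hp hp' hv hv' ⊢
    obtain ⟨rfl, rfl⟩ := h'
    exact ⟨rfl, hp.symm.trans hp', hv.symm.trans hv'⟩

variable {T}

theorem GluedFaces.ne {x y : ι × Fin 4} (h : T.GluedFaces x y) : x ≠ y := by
  obtain ⟨p, h, hp⟩ := h
  rintro rfl
  exact T.glue_ne_self h (by rw [hp])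

variable (T)

/-- The label in the dual graph of the arc given by a glued face. -/
def faceLabel (x : ι × Fin 4) : Sym2 (ι × Fin 4) :=
  match T.glue x.1 x.2 with
  -- An arbitrary value: labels matter only for glued faces.
  | none => s(x, x)
  | some (t, p) => s(x, (t, p x.2))

variable {T}

theorem GluedFaces.faceLabel_eq {x y : ι × Fin 4} (h : T.GluedFaces x y) :
    T.faceLabel x = s(x, y) := by
  obtain ⟨p, h, hp⟩ := h
  simp [faceLabel, h, hp]

theorem faceLabel_eq_iff {x x' y y' : ι × Fin 4} (hx : T.GluedFaces x x')
    (hy : T.GluedFaces y y') : T.faceLabel x = T.faceLabel y ↔ x = y ∨ x = y' := by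
  rw [hx.faceLabel_eq, hy.faceLabel_eq, Sym2.eq_iff]
  have hm := T.isPartialMatching_gluedFaces
  refine ⟨fun h => h.imp And.left And.left, ?_⟩
  rintro (rfl | rfl)
  · exact Or.inl ⟨rfl, hm.unique hx hy⟩
  · exact Or.inr ⟨rfl, hm.unique hx (hm.symm hy)⟩

variable (T) in
theorem dualGraph_isLink_iff {e : Sym2 (ι × Fin 4)} {x y : ι} :
    T.dualGraph.IsLink e x y ↔
      ∃ a b, T.GluedFaces a b ∧ a.1 = x ∧ b.1 = y ∧ T.faceLabel a = e := by
  constructor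
  · rintro ⟨i, p, h, rfl⟩
    have : T.GluedFaces (x, i) (y, p i) := ⟨p, h, rfl⟩
    exact ⟨_, _, this, rfl, rfl, this.faceLabel_eq⟩
  · rintro ⟨⟨t, i⟩, ⟨t', j⟩, h, rfl, rfl, rfl⟩
    have hl := h.faceLabel_eq
    obtain ⟨p, h, hp⟩ := h
    obtain rfl : p i = j := hp
    exact ⟨i, p, h, hl⟩

/-- The start of the induction, before any purse is flattened. As no face is glued to itself,
matched pairs are exactly glued pairs. -/
theorem isRepresentedBy_dualGraph :
    T.dualGraph.IsRepresentedBy Prod.fst (Relation.EqvGen T.GluedFaces) Set.univ T.faceLabel := by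
  have hm := T.isPartialMatching_gluedFaces
  have hM : ∀ a b, Matched (Relation.EqvGen T.GluedFaces) Set.univ a b ↔ T.GluedFaces a b := by
    intro a b
    simp only [Matched, Set.mem_univ, true_and, hm.eqvGen_iff]
    exact ⟨fun h => h.2.resolve_left h.1, fun h => ⟨h.ne, Or.inr h⟩⟩
  refine ⟨fun {e x y} => ?_, fun {a b a' b'} ha hb => ?_⟩
  · simpa only [hM] using T.dualGraph_isLink_iff (e := e) (x := x) (y := y)
  rw [hM] at ha hb
  rw [faceLabel_eq_iff ha hb, hm.eqvGen_iff]
  refine or_congr_right ⟨?_, fun h => ?_⟩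
  · rintro rfl
    exact hm.symm hb
  · exact hm.unique (hm.symm h) hb

end GenTriangulation

/-! ## Flattening purses -/

/-- The vertex on the same side of the quads of type `q` as the vertex `i`. -/
def quadMate : Fin 3 → Fin 4 → Fin 4 :=
  ![![1, 0, 3, 2], ![2, 3, 0, 1], ![3, 2, 1, 0]]

theorem quadMate_quadMate : ∀ q i, quadMate q (quadMate q i) = i := by decide

theorem quadMate_ne : ∀ q i, quadMate q i ≠ i := by decide

theorem quadSide_quadMate : ∀ q i, quadSide q (quadMate q i) = quadSide q i := by decide

theorem eq_or_eq_quadMate : ∀ q i j, quadSide q i = quadSide q j → j = i ∨ j = quadMate q i := by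
  decide

theorem quadJoining_quadMate : ∀ q i, quadJoining i (quadMate q i) = q := by decide

theorem quadJoining_quadMate_left : ∀ q i, quadJoining (quadMate q i) i = q := by decide

theorem quadJoining_ne : ∀ q i v, v ≠ i → v ≠ quadMate q i → quadJoining i v ≠ q := by decide

theorem quadJoining_injective : ∀ i v w, v ≠ i → w ≠ i → quadJoining i v = quadJoining i w →
    v = w := by
  decide

namespace NormalSurface

variable {ι : Type*} {T : GenTriangulation ι} (S : NormalSurface T)

open Classical in
/-- If `t` contains quads, the face `i` of `t` has its middle piece on a purse, and this is
the face containing the other triangle of the purse; otherwise it is `i` itself. -/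
noncomputable def mate (t : ι) (i : Fin 4) : Fin 4 :=
  if h : ∃ q, S.quad t q ≠ 0 then quadMate h.choose i else i

variable {S}

theorem mate_of_quad_ne_zero {t : ι} {q : Fin 3} (h : S.quad t q ≠ 0) (i : Fin 4) :
    S.mate t i = quadMate q i := by
  have h' : ∃ q, S.quad t q ≠ 0 := ⟨q, h⟩
  rw [mate, dif_pos h', S.quad_unique h'.choose_spec h]

theorem mate_of_quad_eq_zero {t : ι} (h : ∀ q, S.quad t q = 0) (i : Fin 4) : S.mate t i = i := by
  rw [mate, dif_neg (by simpa using h)]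

theorem mate_mate (t : ι) (i : Fin 4) : S.mate t (S.mate t i) = i := by
  by_cases h : ∃ q, S.quad t q ≠ 0
  · obtain ⟨q, h⟩ := h
    rw [mate_of_quad_ne_zero h, mate_of_quad_ne_zero h, quadMate_quadMate]
  · push Not at h
    rw [mate_of_quad_eq_zero h, mate_of_quad_eq_zero h]

theorem mate_eq_self_iff {t : ι} {i : Fin 4} : S.mate t i = i ↔ ∀ q, S.quad t q = 0 := by
  refine ⟨fun h q => ?_, fun h => mate_of_quad_eq_zero h i⟩
  by_contra hq
  rw [mate_of_quad_ne_zero hq] at h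
  exact quadMate_ne q i h

variable (S)

/-! ### The flattening as an involution of faces and of corners -/

/-- The flattening of purses, on faces. -/
noncomputable def flipFace (x : ι × Fin 4) : ι × Fin 4 := (x.1, S.mate x.1 x.2)

/-- The flattening of purses, on the corners of faces. -/
noncomputable def flipCorner (x : ι × Fin 4 × Fin 4) : ι × Fin 4 × Fin 4 :=
  (x.1, S.mate x.1 x.2.1, Equiv.swap x.2.1 (S.mate x.1 x.2.1) x.2.2)

theorem flipFace_involutive : Function.Involutive S.flipFace := fun x => by
  simp [flipFace, mate_mate]

theorem flipCorner_involutive : Function.Involutive S.flipCorner := fun x => by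
  simp only [flipCorner, mate_mate]
  rw [Equiv.swap_comm, Equiv.swap_apply_self]

/-- The equivalence relation on faces generated by the gluings and the flattening. -/
abbrev FaceRel : ι × Fin 4 → ι × Fin 4 → Prop := orbitRel T.GluedFaces S.flipFace

/-- The equivalence relation on corners of faces generated by the gluings and the flattening. -/
abbrev CornerRel : ι × Fin 4 × Fin 4 → ι × Fin 4 × Fin 4 → Prop :=
  orbitRel T.GluedCorners S.flipCorner

variable {S}

theorem faceRel_of_cornerRel {x y : ι × Fin 4 × Fin 4} (h : S.CornerRel x y) :
    S.FaceRel (x.1, x.2.1) (y.1, y.2.1) := by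
  induction h with
  | rel x y h =>
    rcases h with ⟨p, h, hp, -⟩ | rfl
    · exact orbitRel_of_rel _ ⟨p, h, hp⟩
    · exact orbitRel_apply _ _ _
  | refl x => exact .refl _
  | symm x y _ ih => exact .symm _ _ ih
  | trans x y z _ _ ih ih' => exact .trans _ _ _ ih ih'

/-- Each elementary identification of faces carries the corners along by a permutation; along a
chain these compose. -/
theorem exists_perm_of_faceRel {x y : ι × Fin 4} (h : S.FaceRel x y) :
    ∃ p : Equiv.Perm (Fin 4), p x.2 = y.2 ∧
      ∀ v, S.CornerRel (x.1, x.2, v) (y.1, y.2, p v) := by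
  induction h with
  | rel x y h =>
    rcases h with ⟨p, h, hp⟩ | rfl
    · exact ⟨p, hp, fun v => orbitRel_of_rel _ ⟨p, h, hp, rfl⟩⟩
    · exact ⟨Equiv.swap x.2 (S.mate x.1 x.2), Equiv.swap_apply_left _ _,
        fun v => orbitRel_apply _ S.flipCorner (x.1, x.2, v)⟩
  | refl x => exact ⟨1, rfl, fun v => .refl _⟩
  | symm x y _ ih =>
    obtain ⟨p, hp, h⟩ := ih
    refine ⟨p⁻¹, by simp [← hp], fun v => (equivalence_orbitRel _ _).symm ?_⟩
    simpa using h (p⁻¹ v)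
  | trans x y z _ _ ih ih' =>
    obtain ⟨p, hp, h⟩ := ih
    obtain ⟨p', hp', h'⟩ := ih'
    exact ⟨p' * p, by simp [hp, hp'], fun v => .trans _ _ _ (h v) (h' (p v))⟩

/-! ## The vertices of collapsed triangles and bigons -/

/-- The corner `v` of the triangle in the middle of face `i` of `t`. -/
abbrev middlePoint (S : NormalSurface T) (t : ι) (i v : Fin 4) : Point ι :=
  S.levelPoint t i v (S.arcs t i v)

theorem middlePoint_cases (t : ι) (i v : Fin 4) :
    S.middlePoint t i v = .vertex t v ∨ (∃ k, S.middlePoint t i v = .triangle t v k) ∨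
      ∃ k, S.middlePoint t i v = .quad t (quadJoining i v) k := by
  unfold middlePoint
  cases S.arcs t i v with
  | zero => exact Or.inl rfl
  | succ n =>
    simp only [levelPoint, arcPoint]
    split_ifs
    · exact Or.inr (Or.inl ⟨_, rfl⟩)
    · exact Or.inr (Or.inr ⟨_, rfl⟩)
    · exact Or.inr (Or.inr ⟨_, rfl⟩)

/-- A vertex or a triangular disc determines `v`, and within one face the quads around different
vertices have different types. -/
theorem middlePoint_injective {t : ι} {i v w : Fin 4} (hv : v ≠ i) (hw : w ≠ i)
    (h : S.middlePoint t i v = S.middlePoint t i w) : v = w := by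
  rcases S.middlePoint_cases t i v with e | ⟨k, e⟩ | ⟨k, e⟩ <;>
    rcases S.middlePoint_cases t i w with e' | ⟨k', e'⟩ | ⟨k', e'⟩ <;>
    rw [e, e'] at h <;> simp only [Point.vertex.injEq, Point.triangle.injEq, Point.quad.injEq,
      reduceCtorEq] at h
  · exact h.2
  · exact h.2.1
  · exact quadJoining_injective i v w hv hw h.2.1

theorem middlePoint_eq_of_quad_eq_zero {t : ι} {i j v : Fin 4}
    (hi : S.quad t (quadJoining i v) = 0) (hj : S.quad t (quadJoining j v) = 0) :
    S.middlePoint t i v = S.middlePoint t j v := by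
  simp only [middlePoint, arcs, hi, hj, add_zero]
  cases h : S.tri t v with
  | zero => rfl
  | succ n => simp [levelPoint, arcPoint, h]

/-- The corner is the quad farthest from `v`. Since quads are numbered from the vertex `0`, this is
the last one if `v` is on the side of `0`, and the first one otherwise. -/
theorem middlePoint_of_quad_ne_zero {t : ι} {i v : Fin 4}
    (h : S.quad t (quadJoining i v) ≠ 0) :
    S.middlePoint t i v = .quad t (quadJoining i v)
      (if quadSide (quadJoining i v) v then S.quad t (quadJoining i v) - 1 else 0) := by
  simp only [middlePoint, arcs]
  obtain ⟨n, hn⟩ := Nat.exists_eq_succ_of_ne_zero h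
  rw [hn, Nat.succ_eq_add_one, ← add_assoc]
  simp [levelPoint, arcPoint, hn]

/-- The flattening of a purse fixes its vertices. -/
theorem middlePoint_quadMate {t : ι} {q : Fin 3} (hq : S.quad t q ≠ 0) {i v : Fin 4}
    (hv : v ≠ i) : S.middlePoint t i v =
      S.middlePoint t (quadMate q i) (Equiv.swap i (quadMate q i) v) := by
  -- In face `i` the quads surround `quadMate q i`, and in the other face they surround `i`; both
  -- corners are the quad bounding the purse. At the two other vertices no quad occurs in either
  -- face, so the corners agree without a swap.
  by_cases h : v = quadMate q i
  · subst h
    rw [Equiv.swap_apply_right, middlePoint_of_quad_ne_zero, middlePoint_of_quad_ne_zero,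
      quadJoining_quadMate, quadJoining_quadMate_left, quadSide_quadMate]
    · rwa [quadJoining_quadMate_left]
    · rwa [quadJoining_quadMate]
  · rw [Equiv.swap_apply_of_ne_of_ne hv h]
    have key : ∀ j, quadJoining j v ≠ q → S.quad t (quadJoining j v) = 0 := fun j hj => by
      by_contra h'
      exact hj (S.quad_unique h' hq)
    exact middlePoint_eq_of_quad_eq_zero (key _ (quadJoining_ne q i v hv h))
      (key _ (quadJoining_ne q _ v h (by rwa [quadMate_quadMate])))

theorem swap_ne_of_ne {i j v : Fin 4} (hv : v ≠ i) : Equiv.swap i j v ≠ j := fun h =>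
  hv (by rw [← Equiv.swap_apply_self i j v, h, Equiv.swap_apply_right])

theorem mem_vertices_middle {t : ι} {i : Fin 4} {P : Point ι} :
    P ∈ (Piece.middle t i : S.Piece).vertices ↔ ∃ v, v ≠ i ∧ S.middlePoint t i v = P := by
  constructor
  · rintro ⟨x, hx, rfl⟩
    cases x with
    | middle t' i' v hv =>
      simp only [PieceCorner.piece, Piece.middle.injEq] at hx
      obtain ⟨rfl, rfl⟩ := hx
      exact ⟨v, hv, rfl⟩
    | corner => simp [PieceCorner.piece] at hx
  · rintro ⟨v, hv, rfl⟩
    exact ⟨.middle t i v hv, rfl, rfl⟩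

theorem vertices_quadMate {t : ι} {q : Fin 3} (hq : S.quad t q ≠ 0) (i : Fin 4) :
    (Piece.middle t i : S.Piece).vertices = (Piece.middle t (quadMate q i) : S.Piece).vertices := by
  have key : ∀ i, (Piece.middle t i : S.Piece).vertices ⊆
      (Piece.middle t (quadMate q i) : S.Piece).vertices := by
    intro i P hP
    rw [mem_vertices_middle] at hP ⊢
    obtain ⟨v, hv, rfl⟩ := hP
    exact ⟨_, swap_ne_of_ne hv, (middlePoint_quadMate hq hv).symm⟩
  refine (key i).antisymm ?_
  have := key (quadMate q i)
  rwa [quadMate_quadMate] at this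

/-- A triangle has more vertices than a bigon. -/
theorem vertices_middle_ne_vertices_corner {t t' : ι} {i i' v : Fin 4} {hv : v ≠ i'}
    {k : Fin (S.arcs t' i' v)} :
    (Piece.middle t i : S.Piece).vertices ≠ (Piece.corner t' i' v hv k : S.Piece).vertices := by
  intro h
  have h2 : (Piece.corner t' i' v hv k : S.Piece).vertices ⊆
      {S.levelPoint t' i' v (k.1 + 1), S.levelPoint t' i' v k.1} := by
    rintro P ⟨x, hx, rfl⟩
    cases x with
    | middle => simp [PieceCorner.piece] at hx
    | corner t'' i'' v' hv' k' far =>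
      simp only [PieceCorner.piece, Piece.corner.injEq] at hx
      obtain ⟨rfl, rfl, rfl, hk⟩ := hx
      obtain rfl := eq_of_heq hk
      cases far
      · exact Or.inr rfl
      · exact Or.inl rfl
  obtain ⟨a, b, c, ha, hb, hc, hab, hac, hbc⟩ : ∃ a b c : Fin 4, a ≠ i ∧ b ≠ i ∧ c ≠ i ∧
      a ≠ b ∧ a ≠ c ∧ b ≠ c := by
    clear h
    decide +revert
  have hm : ∀ u, u ≠ i → S.middlePoint t i u = S.levelPoint t' i' v (k.1 + 1) ∨
      S.middlePoint t i u = S.levelPoint t' i' v k.1 := fun u hu =>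
    h2 (h ▸ mem_vertices_middle.2 ⟨u, hu, rfl⟩)
  have hi : ∀ {u w}, u ≠ i → w ≠ i → u ≠ w → ∀ {P},
      S.middlePoint t i u = P → S.middlePoint t i w = P → False :=
    fun hu hw huw _ e e' => huw (middlePoint_injective hu hw (e.trans e'.symm))
  -- Pigeonhole: three distinct corners would share two points.
  rcases hm a ha with e | e <;> rcases hm b hb with e' | e' <;> rcases hm c hc with e'' | e''
  exacts [hi ha hb hab e e', hi ha hb hab e e', hi ha hc hac e e'', hi hb hc hbc e' e'',
    hi hb hc hbc e' e'', hi ha hc hac e e'', hi ha hb hab e e', hi ha hb hab e e']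

/-! ## Identifications of corners of triangles -/

/-- The corner of a face at a corner of its middle piece. -/
def PieceCorner.toCorner : S.PieceCorner → Option (ι × Fin 4 × Fin 4)
  | .middle t i v _ => some (t, i, v)
  | .corner .. => none

/-- `Option.Rel` also records that triangles are never identified with bigons. The triangles of a
purse lie in face `i` and its mate, and since their corners are distinct points, fixing the vertices
leaves only the identity or `flipCorner`. -/
theorem cornerRel_of_identified {x y : S.PieceCorner} (h : S.Identified x y) :
    Option.Rel S.CornerRel x.toCorner y.toCorner := by
  cases h with
  | glue_middle h hv => exact .some (orbitRel_of_rel _ ⟨_, h, rfl, rfl⟩)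
  | glue_corner h hv k far => exact .none
  | flatten hc hx hy hxy h =>
    cases x with
    | corner t i v hv k far =>
      cases y with
      | corner => exact .none
      | middle => exact absurd hxy.symm vertices_middle_ne_vertices_corner
    | middle t i v hv =>
      cases y with
      | corner => exact absurd hxy vertices_middle_ne_vertices_corner
      | middle t' j w hw =>
        refine .some ?_
        cases hx with
        | middle_core _ _ h0 => exact absurd trivial hc
        | middle_outer _ _ q hq =>
          generalize hs : (!quadSide q i) = s at hy
          cases hy with
          | middle_outer =>
            have hs' : quadSide q i = quadSide q j := by simpa using hs
            change S.middlePoint t i v = S.middlePoint t j w at h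
            rcases eq_or_eq_quadMate q i j hs' with rfl | rfl
            · obtain rfl := middlePoint_injective hv hw h
              exact .refl _
            · rw [middlePoint_quadMate hq hv] at h
              obtain rfl := middlePoint_injective (swap_ne_of_ne hv) hw h
              have := orbitRel_apply T.GluedCorners S.flipCorner (t, i, v)
              simpa only [flipCorner, mate_of_quad_ne_zero hq] using this

theorem cornerRel_of_eqvGen {x y : S.PieceCorner} (h : Relation.EqvGen S.Identified x y) :
    Option.Rel S.CornerRel x.toCorner y.toCorner := by
  have he := equivalence_orbitRel T.GluedCorners S.flipCorner
  induction h with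
  | rel x y h => exact cornerRel_of_identified h
  | refl x =>
    cases x.toCorner with
    | none => exact .none
    | some a => exact .some (he.refl a)
  | symm x y _ ih =>
    generalize x.toCorner = a at ih
    generalize y.toCorner = b at ih
    cases ih with
    | none => exact .none
    | some h => exact .some (he.symm h)
  | trans x y z _ _ ih ih' =>
    generalize x.toCorner = a at ih
    generalize y.toCorner = b at ih ih'
    generalize z.toCorner = c at ih'
    cases ih with
    | none => exact ih'
    | some h =>
      cases ih' with
      | some h' => exact .some (he.trans h h')

/-- Gluing and flipping both preserve whether `v = i`, so a chain that starts at a genuine corner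
never passes through a triple standing for a whole face. -/
theorem eqvGen_of_cornerRel {x y : ι × Fin 4 × Fin 4} (h : S.CornerRel x y) :
    (x.2.2 = x.2.1 ∧ y.2.2 = y.2.1) ∨ ∃ (hx : x.2.2 ≠ x.2.1) (hy : y.2.2 ≠ y.2.1),
      Relation.EqvGen S.Identified (.middle x.1 x.2.1 x.2.2 hx) (.middle y.1 y.2.1 y.2.2 hy) := by
  induction h with
  | rel x y h =>
    obtain ⟨t, i, v⟩ := x
    by_cases hv : v = i
    · subst hv
      rcases h with ⟨p, -, hp, hp'⟩ | rfl
      · exact Or.inl ⟨rfl, hp'.symm.trans hp⟩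
      · exact Or.inl ⟨rfl, Equiv.swap_apply_left _ _⟩
    · right
      rcases h with ⟨p, h, hp, hp'⟩ | rfl
      · obtain ⟨t', j, w⟩ := y
        obtain rfl : p i = j := hp
        obtain rfl : p v = w := hp'
        exact ⟨hv, p.injective.ne hv, .rel _ _ (.glue_middle h hv)⟩
      · refine ⟨hv, swap_ne_of_ne hv, ?_⟩
        by_cases hq : ∃ q, S.quad t q ≠ 0
        · obtain ⟨q, hq⟩ := hq
          simp only [flipCorner, mate_of_quad_ne_zero hq]
          refine .rel _ _ (.flatten (c := .outer t q hq (!quadSide q i)) id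
            (.middle_outer t i q hq) ?_ (vertices_quadMate hq i) (middlePoint_quadMate hq hv))
          have := IsFace.middle_outer (S := S) t (quadMate q i) q hq
          rwa [quadSide_quadMate] at this
        · push Not at hq
          simp only [flipCorner, mate_of_quad_eq_zero hq, Equiv.swap_self, Equiv.refl_apply]
          exact .refl _
  | refl x =>
    by_cases hx : x.2.2 = x.2.1
    · exact Or.inl ⟨hx, hx⟩
    · exact Or.inr ⟨hx, hx, .refl _⟩
  | symm x y _ ih =>
    exact ih.imp And.symm fun ⟨hx, hy, h⟩ => ⟨hy, hx, .symm _ _ h⟩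
  | trans x y z _ _ ih ih' =>
    rcases ih with ⟨hx, hy⟩ | ⟨hx, hy, h⟩ <;> rcases ih' with ⟨hy', hz⟩ | ⟨hy', hz, h'⟩
    · exact Or.inl ⟨hx, hz⟩
    · exact absurd hy hy'
    · exact absurd hy' hy
    · exact Or.inr ⟨hx, hz, .trans _ _ _ h h'⟩

/-! ## The crushed triangulation -/

theorem TetCell.quad_eq_zero (c : S.TetCell) (q : Fin 3) : S.quad c.1.tet q = 0 := by
  obtain ⟨c, hc⟩ := c
  cases c with
  | core t h => exact h q
  | tip | slab | outer => exact absurd hc id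

theorem TetCell.tet_injective : Function.Injective fun c : S.TetCell => c.1.tet := by
  rintro ⟨c, hc⟩ ⟨d, hd⟩ h
  cases c with
  | core t h0 =>
    cases d with
    | core t' h0' =>
      obtain rfl : t = t' := h
      rfl
    | tip | slab | outer => exact absurd hd id
  | tip | slab | outer => exact absurd hc id

/-- The condition on a gluing of the crushed triangulation, in terms of `CornerRel`. -/
def IsGluing (S : NormalSurface T) (c : S.TetCell) (i : Fin 4) (d : S.TetCell)
    (p : Equiv.Perm (Fin 4)) : Prop :=
  (d, p i) ≠ (c, i) ∧ ∀ v, S.CornerRel (c.1.tet, i, v) (d.1.tet, p i, p v)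

theorem isGluing_iff {c : S.TetCell} {i : Fin 4} {d : S.TetCell} {p : Equiv.Perm (Fin 4)} :
    S.IsGluing c i d p ↔ (d, p i) ≠ (c, i) ∧ ∀ (v : Fin 4) (hv : v ≠ i),
      Relation.EqvGen S.Identified (.middle c.1.tet i v hv)
        (.middle d.1.tet (p i) (p v) (p.injective.ne hv)) := by
  refine and_congr_right fun _ => ⟨fun h v hv => ?_, fun h => ?_⟩
  · rcases eqvGen_of_cornerRel (h v) with ⟨h, -⟩ | ⟨_, _, h⟩
    · exact absurd h hv
    · exact h
  · have h' : ∀ v, v ≠ i → S.CornerRel (c.1.tet, i, v) (d.1.tet, p i, p v) := fun v hv => by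
      cases cornerRel_of_eqvGen (h v hv) with
      | some h => exact h
    intro v
    by_cases hv : v = i
    · subst hv
      -- For the triple that stands for the face itself, any genuine corner `w` shows that the faces
      -- are related, and the resulting permutation agrees with `p` at `i`.
      obtain ⟨w, hw⟩ := exists_ne v
      obtain ⟨p', hp', hc⟩ := exists_perm_of_faceRel (faceRel_of_cornerRel (h' w hw))
      have := hc v
      rwa [show p' v = p v from hp'] at this
    · exact h' v hv

theorem isCrushing_iff {T' : GenTriangulation S.TetCell} :
    S.IsCrushing T' ↔ ∀ c i d p, T'.glue c i = some (d, p) ↔ S.IsGluing c i d p := by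
  simp only [isGluing_iff, IsCrushing]

theorem IsGluing.symm {c : S.TetCell} {i : Fin 4} {d : S.TetCell} {p : Equiv.Perm (Fin 4)}
    (h : S.IsGluing c i d p) : S.IsGluing d (p i) c p⁻¹ := by
  refine ⟨by simpa using h.1.symm, fun v => (equivalence_orbitRel _ _).symm ?_⟩
  simpa using h.2 (p⁻¹ v)

theorem isPairing_faceRel [Finite ι] : IsPairing S.FaceRel (Function.fixedPoints S.flipFace) :=
  T.isPartialMatching_gluedFaces.isPairing_orbitRel S.flipFace_involutive

theorem mem_fixedPoints_flipFace {t : ι} {i : Fin 4} :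
    (t, i) ∈ Function.fixedPoints S.flipFace ↔ ∀ q, S.quad t q = 0 := by
  simp [Function.mem_fixedPoints, Function.IsFixedPt, flipFace, mate_eq_self_iff]

theorem TetCell.mem_fixedPoints_flipCorner (c : S.TetCell) (i v : Fin 4) :
    (c.1.tet, i, v) ∈ Function.fixedPoints S.flipCorner := by
  simp [Function.mem_fixedPoints, Function.IsFixedPt, flipCorner,
    mate_of_quad_eq_zero c.quad_eq_zero]

/-- Corners in tetrahedral cells are fixed by `flipCorner`, so a class contains at most two of them.
Of a corner and its two candidate partners, the first differs from both others, so the partners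
coincide. -/
theorem IsGluing.unique [Finite ι] {c : S.TetCell} {i : Fin 4} {d d' : S.TetCell}
    {p p' : Equiv.Perm (Fin 4)} (h : S.IsGluing c i d p) (h' : S.IsGluing c i d' p') :
    d = d' ∧ p = p' := by
  have hp : IsPairing S.CornerRel (Function.fixedPoints S.flipCorner) :=
    T.isPartialMatching_gluedCorners.isPairing_orbitRel S.flipCorner_involutive
  have ne : ∀ {d : S.TetCell} {p : Equiv.Perm (Fin 4)} {v}, S.IsGluing c i d p →
      (c.1.tet, i, v) ≠ (d.1.tet, p i, p v) := by
    intro d p v h e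
    simp only [Prod.mk.injEq] at e
    exact h.1 (by rw [TetCell.tet_injective e.1, ← e.2.1])
  have key : ∀ v, d = d' ∧ p v = p' v := fun v => by
    rcases hp.at_most_two (c.mem_fixedPoints_flipCorner i v) (d.mem_fixedPoints_flipCorner _ _)
      (d'.mem_fixedPoints_flipCorner _ _) (h.2 v) (h'.2 v) with e | e | e
    · exact absurd e (ne h)
    · exact absurd e (ne h')
    · simp only [Prod.mk.injEq] at e
      exact ⟨TetCell.tet_injective e.1, e.2.2⟩
  exact ⟨(key 0).1, Equiv.ext fun v => (key v).2⟩

theorem exists_isCrushing [Finite ι] (S : NormalSurface T) :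
    ∃ T' : GenTriangulation S.TetCell, S.IsCrushing T' := by
  classical
  let g : S.TetCell → Fin 4 → Option (S.TetCell × Equiv.Perm (Fin 4)) := fun c i =>
    if h : ∃ x : S.TetCell × Equiv.Perm (Fin 4), S.IsGluing c i x.1 x.2 then some h.choose
    else none
  have hg : ∀ {c i d p}, g c i = some (d, p) ↔ S.IsGluing c i d p := by
    intro c i d p
    by_cases h : ∃ x : S.TetCell × Equiv.Perm (Fin 4), S.IsGluing c i x.1 x.2
    · simp only [g, dif_pos h, Option.some.injEq]
      have hs := h.choose_spec
      refine ⟨fun e => by rwa [e] at hs, fun h' => Prod.ext (hs.unique h').1 (hs.unique h').2⟩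
    · simp only [g, dif_neg h, reduceCtorEq, false_iff]
      exact fun h' => h ⟨(d, p), h'⟩
  exact ⟨⟨g, fun h => hg.2 (hg.1 h).symm, fun h => (hg.1 h).1⟩,
    isCrushing_iff.2 fun _ _ _ _ => hg⟩

theorem IsCrushing.unique {T₁ T₂ : GenTriangulation S.TetCell} (h₁ : S.IsCrushing T₁)
    (h₂ : S.IsCrushing T₂) : T₁ = T₂ := by
  have h : T₁.glue = T₂.glue := by
    funext c i
    refine Option.ext fun ⟨d, p⟩ => ?_
    exact (h₁ c i d p).trans (h₂ c i d p).symm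
  cases T₁
  cases T₂
  simpa using h

/-! ## The dual graph of the crushed triangulation -/

/-- The bijection of corners needed for a gluing comes for free from `exists_perm_of_faceRel`, so
the dual graph depends only on the relation between faces. -/
theorem IsCrushing.gluedFaces_iff {T' : GenTriangulation S.TetCell} (h : S.IsCrushing T')
    {a b : S.TetCell × Fin 4} : T'.GluedFaces a b ↔
      Matched S.FaceRel (Function.fixedPoints S.flipFace) (a.1.1.tet, a.2) (b.1.1.tet, b.2) := by
  rw [isCrushing_iff] at h
  obtain ⟨c, i⟩ := a
  obtain ⟨d, j⟩ := b
  constructor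
  · rintro ⟨p, hp, hj⟩
    obtain rfl : p i = j := hj
    have hp := (h _ _ _ _).1 hp
    refine ⟨mem_fixedPoints_flipFace.2 c.quad_eq_zero, mem_fixedPoints_flipFace.2 d.quad_eq_zero,
      fun e => ?_, faceRel_of_cornerRel (hp.2 i)⟩
    simp only [Prod.mk.injEq] at e
    exact hp.1 (by rw [TetCell.tet_injective e.1, ← e.2])
  · rintro ⟨-, -, hne, hr⟩
    obtain ⟨p, hp, hc⟩ := exists_perm_of_faceRel hr
    obtain rfl : p i = j := hp
    refine ⟨p, (h _ _ _ _).2 ⟨fun e => ?_, hc⟩, rfl⟩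
    simp only [Prod.mk.injEq] at e
    exact hne (by simp [e.1, e.2])

/-- `flipFace` preserves the tetrahedron, so each pair of joined classes meets at one node. The
pairing property is carried through the induction because each reduction step needs it. -/
theorem reducesTo_faceRel [Finite ι] (S : NormalSurface T) :
    T.dualGraph.ReducesTo Prod.fst S.FaceRel (Function.fixedPoints S.flipFace) :=
  (involution_induction
    (C := fun r U => IsPairing r U ∧ T.dualGraph.ReducesTo Prod.fst r U)
    (rel := fun a b => a.1 = b.1)
    ⟨T.isPartialMatching_gluedFaces.isPairing, T.dualGraph, T.faceLabel, .refl, rfl,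
      GenTriangulation.isRepresentedBy_dualGraph⟩
    (fun _ _ _ _ h ha hb hab => ⟨h.1.joinClasses ha hb, h.2.joinClasses h.1 ha hb hab⟩)
    S.flipFace_involutive fun _ => rfl).2

theorem IsCrushing.isImmersionOf [Finite ι] {T' : GenTriangulation S.TetCell}
    (h : S.IsCrushing T') : T'.dualGraph.IsImmersionOf T.dualGraph := by
  obtain ⟨H, l, h1, h2, h3⟩ := S.reducesTo_faceRel
  have hp := S.isPairing_faceRel
  set A : Set ι := {t | ∃ q, S.quad t q ≠ 0} with hA
  have hnA : ∀ t, t ∉ A ↔ ∀ q, S.quad t q = 0 := fun t => by simp [hA]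
  -- The nodes in `A` no longer carry arcs, because their faces are not fixed by `flipFace`; the
  -- other nodes correspond to the `core` cells.
  refine ⟨H.deleteVerts A, h1.trans (H.reflTransGen_deleteVerts (Set.toFinite A) ?_), ?_⟩
  · rw [h2]
    exact fun _ _ => trivial
  refine Graph.isIsomorphic_of_matching (M := T'.GluedFaces) (π := Prod.fst)
    (l := fun a => l (a.1.1.tet, a.2)) (l' := T'.faceLabel) TetCell.tet_injective ?_ rfl ?_
    (fun _ _ _ => T'.dualGraph_isLink_iff) ?_
  · ext t
    rw [Graph.vertexSet_deleteVerts, h2, Set.mem_sdiff, hnA]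
    constructor
    · rintro ⟨-, ht⟩
      exact ⟨⟨.core t ht, trivial⟩, rfl⟩
    · rintro ⟨c, rfl⟩
      exact ⟨trivial, c.quad_eq_zero⟩
  · intro e x y
    rw [Graph.deleteVerts_isLink, h3.isLink_iff, hnA, hnA]
    constructor
    · rintro ⟨⟨⟨t, i⟩, ⟨t', j⟩, hm, rfl, rfl, rfl⟩, ht, ht'⟩
      exact ⟨(⟨.core t ht, trivial⟩, i), (⟨.core t' ht', trivial⟩, j), h.gluedFaces_iff.2 hm,
        rfl, rfl, rfl⟩
    · rintro ⟨⟨c, i⟩, ⟨d, j⟩, hm, rfl, rfl, rfl⟩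
      exact ⟨⟨_, _, h.gluedFaces_iff.1 hm, rfl, rfl, rfl⟩, c.quad_eq_zero, d.quad_eq_zero⟩
  · intro a b c d hab hcd
    have hm := h.gluedFaces_iff.1 hab
    have hm' := h.gluedFaces_iff.1 hcd
    have inj : ∀ {a b : S.TetCell × Fin 4}, (a.1.1.tet, a.2) = (b.1.1.tet, b.2) → a = b := by
      intro a b e
      simp only [Prod.mk.injEq] at e
      exact Prod.ext (TetCell.tet_injective e.1) e.2
    rw [h3.label_eq_iff hm hm', GenTriangulation.faceLabel_eq_iff hab hcd]
    constructor
    · intro hr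
      -- The class of `c` already contains the two different faces `c` and `d`, so `a` is one of
      -- them.
      rcases hp.at_most_two hm'.1 hm.1 hm'.2.1 (hp.equiv.symm hr) hm'.2.2.2 with e | e | e
      · exact Or.inl (inj e).symm
      · exact absurd e hm'.2.2.1
      · exact Or.inr (inj e)
    · rintro (rfl | rfl)
      · exact hp.equiv.refl _
      · exact hp.equiv.symm hm'.2.2.2

end NormalSurface

theorem mainTheorem3 {ι : Type*} [Finite ι] (T : GenTriangulation ι) (S : NormalSurface T) :
    (∃! T' : GenTriangulation S.TetCell, S.IsCrushing T') ∧
      ∀ T' : GenTriangulation S.TetCell, S.IsCrushing T' →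
        T'.dualGraph.IsImmersionOf T.dualGraph :=
  ⟨existsUnique_of_exists_of_unique S.exists_isCrushing fun _ _ h₁ h₂ => h₁.unique h₂,
    fun _ h => h.isImmersionOf⟩
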